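/- Let $L$ be a Lie algebra over a commutative ring (for example, over an arbitrary field), graded by an arbitrary group $(G,\cdot)$: $L=\bigoplus_{g\in G}L_g$ with $[L_g,L_h]\subseteq L_{g\cdot h}$ for all $g,h\in G$. Let $X=\{g\in G : L_g\neq 0\}$ be the support of the grading. Assume that $X$ is arithmetically-free: $X$ is finite and, for every abelian subgroup $H$ of $G$, there are no $x,y\in X\cap H$ with $x\langle y\rangle\subseteq X\cap H$. Assume also that $X$ is good-ordered: every subset $Y$ of $X$ whose elements commute pairwise admits a total order $<$ such that there are no $x,y\in Y$ with $xy\in Y$ and $x<xy<y$. Let $\delta(X)$ be the least integer $\delta\ge 1$ such that, for every abelian subgroup $H$ of $G$ and all $a,b_1,\dots,b_\delta\in X\cap H$, there is a subset $I\subseteq\{1,\dots,\delta\}$ with $a\prod_{i\in I}b_i\notin X$. Then $L$ is nilpotent. If $|X|\ge 3$, its nilpotency class $c(L)$ satisfies $$c(L)\;\le\;\delta(X)^0+\delta(X)^1+\cdots+\delta(X)^{2^{|X|-1}-2}\;\le\;|X|^{2^{|X|-1}-1}.$$ If $1\le |X|\le 2$, then still $$\sum_{0\le i<2^{|X|-1}-1}\delta(X)^i\;\le\;|X|^{2^{|X|-1}-1}\qquad\text{and}\qquad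 c(L)\;\le\;|X|^{2^{|X|-1}-1}.$$ -/

import Mathlib

/-- The set of periods of a subset `Y` of an abelian group `A`: those `g` for which `Y` contains
a full coset `x⟨g⟩` with `x ∈ Y`. -/
def periods {A : Type*} [CommGroup A] (Y : Set A) : Set A :=
  {g | ∃ x ∈ Y, ∀ h ∈ Subgroup.zpowers g, x * h ∈ Y}

/-- The trace `X ∩ H` of a subset `X` of `G`, as a subset of the subgroup `H`. -/
def traceOn {G : Type*} [Group G] (X : Set G) (H : Subgroup G) : Set H :=
  {h | (h : G) ∈ X}

open scoped IsMulCommutative in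
/-- A finite subset `X` of an arbitrary group is arithmetically-free if, for every abelian
subgroup `H`, no element of `X ∩ H` is a period (in `H`) of `X ∩ H`. -/
def ArithmeticallyFree {G : Type*} [Group G] (X : Set G) : Prop :=
  X.Finite ∧ ∀ (H : Subgroup G) [IsMulCommutative H],
    traceOn X H ∩ periods (traceOn X H) = ∅

/-- `Y` has a good-ordering: a total order on `Y` such that there are no `x, y ∈ Y`
with `x * y ∈ Y` and `x < x * y < y`. -/
def HasGoodOrdering {G : Type*} [Group G] (Y : Set G) : Prop :=
  ∃ _ : LinearOrder Y, ∀ x y z : Y, (x : G) * (y : G) = (z : G) → ¬ (x < z ∧ z < y)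

/-- A subset of an arbitrary group is good-ordered if each of its abelian (that is, pairwise
commuting) subsets has a good-ordering. -/
def GoodOrdered {G : Type*} [Group G] (X : Set G) : Prop :=
  ∀ Y : Set G, Y ⊆ X → (∀ x ∈ Y, ∀ y ∈ Y, x * y = y * x) → HasGoodOrdering Y

/-- The property of `d` which defines the invariant `δ` of a subset `Y` of an abelian group: for
all `a, b₁, …, b_d ∈ Y` there is `I ⊆ {1, …, d}` such that `a * ∏_{i ∈ I} b_i ∉ Y`. -/
def EscapesIn {A : Type*} [CommGroup A] (Y : Set A) (d : ℕ) : Prop :=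
  ∀ a ∈ Y, ∀ b : Fin d → A, (∀ i, b i ∈ Y) →
    ∃ I : Finset (Fin d), a * ∏ i ∈ I, b i ∉ Y

open scoped IsMulCommutative in
/-- The invariant `δ(X)` of a subset of an arbitrary group: the least positive integer `d` with
the above property for all the sets `X ∩ H`, where `H` is an abelian subgroup. -/
noncomputable def deltaInv {G : Type*} [Group G] (X : Set G) : ℕ :=
  sInf {d : ℕ | 1 ≤ d ∧ ∀ (H : Subgroup G) [IsMulCommutative H], EscapesIn (traceOn X H) d}

/-- A grading of the Lie algebra `L` by the group `G`: a decomposition `L = ⨁ g, 𝓛 g` into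
submodules such that `⁅𝓛 g, 𝓛 h⁆ ⊆ 𝓛 (g * h)`. -/
structure IsGroupGrading {G K L : Type*} [Group G] [DecidableEq G] [CommRing K] [LieRing L]
    [LieAlgebra K L] (𝓛 : G → Submodule K L) : Prop where
  isInternal : DirectSum.IsInternal 𝓛
  lie_mem : ∀ ⦃g h : G⦄ ⦃x y : L⦄, x ∈ 𝓛 g → y ∈ 𝓛 h → ⁅x, y⁆ ∈ 𝓛 (g * h)

/-- The support of a grading: the set of all `g` with `𝓛 g ≠ 0`. -/
def gradingSupport {G K L : Type*} [CommRing K] [LieRing L] [LieAlgebra K L]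
    (𝓛 : G → Submodule K L) : Set G :=
  {g | 𝓛 g ≠ ⊥}

/-! The grading reduces to abelian groups. A nonzero iterated bracket of homogeneous elements forces
their degrees to commute pairwise (`commute_of_listLie_ne_zero`), so it lives over the abelian
subgroup they generate. It therefore suffices to kill the lower central families over each trace `X
∩ H` (`lowerCentralSeries_eq_bot`).

Over an abelian group, rank the support by a good ordering, with ranks at most `k = |X|`. If `u`,
`v` and `u * v` all lie in the support, the rank of `u * v` is below both others or above both
(`lt_or_lt`). A Kreknin-type elimination (`derivedFamily_le_genFamily`) then pushes deep derived
terms into the subalgebra generated by the top-ranked component. Reversing the order does the same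
for the bottom one. These two subalgebras commute, which gives derived length at most `2 ^ (k - 1) -
1` when `k ≥ 3` (`derivedFamily_eq_bot`).

Solvability becomes nilpotency through `δ`: acting by `δ` homogeneous elements moves one step down
the lower central series of the derived algebra (`lowerCentralFamily_eq_bot`). Each further derived
step turns a class bound `c` into `δ * c + 1`, hence the geometric sum. Arithmetic freeness gives `δ
≤ |X|` (`escapesIn_of_ncard_le`). Supports of size at most 2 are handled directly. -/

/-! ### Graded families and their derived and lower central terms -/

/-- A family of submodules of a Lie algebra, indexed by a group, with `⁅V u, V v⁆ ⊆ V (u * v)`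
and whose nonzero members are indexed by elements of `X`. -/
structure GradedFamily {A K L : Type*} [Group A] [CommRing K] [LieRing L] [LieAlgebra K L]
    (X : Set A) (V : A → Submodule K L) : Prop where
  lie_mem : ∀ ⦃u v : A⦄ ⦃x y : L⦄, x ∈ V u → y ∈ V v → ⁅x, y⁆ ∈ V (u * v)
  mem_support : ∀ ⦃g : A⦄ ⦃x : L⦄, x ∈ V g → x ≠ 0 → g ∈ X

/-- The componentwise bracket of two families of submodules. -/
def lieProd {A K L : Type*} [Group A] [CommRing K] [LieRing L] [LieAlgebra K L]
    (V W : A → Submodule K L) (g : A) : Submodule K L :=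
  Submodule.span K {z | ∃ u v, u * v = g ∧ ∃ x ∈ V u, ∃ y ∈ W v, ⁅x, y⁆ = z}

/-- The iterated derived families. -/
def derivedFamily {A K L : Type*} [Group A] [CommRing K] [LieRing L] [LieAlgebra K L]
    (V : A → Submodule K L) (n : ℕ) : A → Submodule K L :=
  (fun W => lieProd W W)^[n] V

/-- The terms of the lower central series of a family. -/
def lowerCentralFamily {A K L : Type*} [Group A] [CommRing K] [LieRing L] [LieAlgebra K L]
    (V : A → Submodule K L) (n : ℕ) : A → Submodule K L :=
  (lieProd V)^[n] V

section Family

variable {A K L : Type*} [Group A] [CommRing K] [LieRing L] [LieAlgebra K L]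
  {V W V' W' F : A → Submodule K L} {X : Set A}

theorem lie_mem_lieProd {u v g : A} {x y : L} (hx : x ∈ V u) (hy : y ∈ W v) (h : u * v = g) :
    ⁅x, y⁆ ∈ lieProd V W g :=
  Submodule.subset_span ⟨u, v, h, x, hx, y, hy, rfl⟩

theorem lieProd_apply_le {g : A} {P : Submodule K L}
    (h : ∀ u v, u * v = g → ∀ x ∈ V u, ∀ y ∈ W v, ⁅x, y⁆ ∈ P) : lieProd V W g ≤ P := by
  refine Submodule.span_le.2 ?_
  rintro _ ⟨u, v, huv, x, hx, y, hy, rfl⟩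
  exact h u v huv x hx y hy

theorem lieProd_le (h : ∀ u v, ∀ x ∈ V u, ∀ y ∈ W v, ⁅x, y⁆ ∈ F (u * v)) : lieProd V W ≤ F := by
  intro g
  refine lieProd_apply_le ?_
  rintro u v rfl x hx y hy
  exact h u v x hx y hy

theorem lieProd_mono (hV : V ≤ V') (hW : W ≤ W') : lieProd V W ≤ lieProd V' W' :=
  lieProd_le fun u v _ hx _ hy => lie_mem_lieProd (hV u hx) (hW v hy) rfl

theorem lie_right_mem_of_lieProd {g : A} {x z : L} {P : Submodule K L}
    (h : ∀ u v, u * v = g → ∀ y ∈ V u, ∀ w ∈ W v, ⁅x, ⁅y, w⁆⁆ ∈ P) (hz : z ∈ lieProd V W g) :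
    ⁅x, z⁆ ∈ P := by
  have : lieProd V W g ≤ P.comap (LieModule.toEnd K L L x) := lieProd_apply_le h
  exact this hz

theorem derivedFamily_succ (n : ℕ) :
    derivedFamily V (n + 1) = lieProd (derivedFamily V n) (derivedFamily V n) :=
  Function.iterate_succ_apply' _ _ _

theorem derivedFamily_succ' (n : ℕ) :
    derivedFamily V (n + 1) = derivedFamily (lieProd V V) n :=
  Function.iterate_succ_apply _ _ _

theorem derivedFamily_add (m n : ℕ) :
    derivedFamily V (m + n) = derivedFamily (derivedFamily V n) m :=
  Function.iterate_add_apply _ _ _ _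

theorem lowerCentralFamily_zero : lowerCentralFamily V 0 = V := rfl

theorem lowerCentralFamily_succ (n : ℕ) :
    lowerCentralFamily V (n + 1) = lieProd V (lowerCentralFamily V n) :=
  Function.iterate_succ_apply' _ _ _

namespace GradedFamily

theorem lieProd_le_self (hV : GradedFamily X V) : lieProd V V ≤ V :=
  lieProd_le fun _ _ _ hx _ hy => hV.lie_mem hx hy

theorem eq_zero (hV : GradedFamily X V) {g : A} {x : L} (hx : x ∈ V g) (hg : g ∉ X) : x = 0 :=
  by_contra fun h => hg (hV.mem_support hx h)

theorem lie_eq_zero (hV : GradedFamily X V) {u v : A} {x y : L} (hx : x ∈ V u) (hy : y ∈ V v)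
    (huv : u * v ∉ X) : ⁅x, y⁆ = 0 :=
  hV.eq_zero (hV.lie_mem hx hy) huv

theorem lieProd_self (hV : GradedFamily X V) : GradedFamily X (lieProd V V) where
  lie_mem _ _ _ _ hx hy :=
    lie_mem_lieProd (hV.lieProd_le_self _ hx) (hV.lieProd_le_self _ hy) rfl
  mem_support _ _ hx := hV.mem_support (hV.lieProd_le_self _ hx)

theorem derivedFamily (hV : GradedFamily X V) (n : ℕ) :
    GradedFamily X (derivedFamily V n) := by
  induction n with
  | zero => exact hV
  | succ n ih => rw [derivedFamily_succ]; exact ih.lieProd_self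

theorem derivedFamily_antitone (hV : GradedFamily X V) : Antitone (_root_.derivedFamily V) :=
  antitone_nat_of_succ_le fun n => by
    rw [derivedFamily_succ]; exact (hV.derivedFamily n).lieProd_le_self

theorem derivedFamily_le (hV : GradedFamily X V) (n : ℕ) : _root_.derivedFamily V n ≤ V :=
  hV.derivedFamily_antitone (Nat.zero_le n)

theorem lowerCentralFamily_antitone (hV : GradedFamily X V) : Antitone (lowerCentralFamily V) :=
  antitone_nat_of_succ_le fun n => by
    induction n with
    | zero => exact hV.lieProd_le_self
    | succ n ih =>
      rw [lowerCentralFamily_succ (n := n + 1)]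
      refine (lieProd_mono le_rfl ih).trans ?_
      rw [← lowerCentralFamily_succ]

end GradedFamily

end Family

/-! ### Iterated brackets along a list -/

/-- The iterated left action of a list of pairs (degree, element). -/
def listLie {A L : Type*} [LieRing L] (l : List (A × L)) (z : L) : L :=
  l.foldr (fun p w => ⁅p.2, w⁆) z

@[simp] theorem listLie_nil {A L : Type*} [LieRing L] (z : L) : listLie ([] : List (A × L)) z = z := rfl

@[simp] theorem listLie_cons {A L : Type*} [LieRing L] (p : A × L) (l : List (A × L)) (z : L) :
    listLie (p :: l) z = ⁅p.2, listLie l z⁆ := rfl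

theorem listLie_append {A L : Type*} [LieRing L] (l l' : List (A × L)) (z : L) :
    listLie (l ++ l') z = listLie l (listLie l' z) := List.foldr_append

theorem listLie_zero {A L : Type*} [LieRing L] (l : List (A × L)) : listLie l 0 = 0 := by
  induction l with
  | nil => rfl
  | cons p l ih => rw [listLie_cons, ih, lie_zero]

/-! ### From derived length to nilpotency class -/

section Class

variable {A K L : Type*} [CommGroup A] [CommRing K] [LieRing L] [LieAlgebra K L]
  {V W : A → Submodule K L} {X : Set A}

theorem lieProd_lieProd_le {U : A → Submodule K L} :
    lieProd V (lieProd W U) ≤ lieProd (lieProd V W) U ⊔ lieProd W (lieProd V U) := by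
  refine lieProd_le fun u v x hx y hy => lie_right_mem_of_lieProd ?_ hy
  rintro s t rfl y hy z hz
  rw [leibniz_lie]
  refine Submodule.add_mem_sup (lie_mem_lieProd (lie_mem_lieProd hx hy rfl) hz (mul_assoc _ _ _)) ?_
  exact lie_mem_lieProd hy (lie_mem_lieProd hx hz rfl) (mul_left_comm _ _ _)

namespace GradedFamily

theorem lieProd_lowerCentralFamily_le (hV : GradedFamily X V) (n : ℕ) :
    lieProd V (lowerCentralFamily (lieProd V V) n) ≤ lowerCentralFamily (lieProd V V) n := by
  induction n with
  | zero => exact lieProd_mono le_rfl hV.lieProd_le_self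
  | succ n ih =>
    rw [lowerCentralFamily_succ]
    refine lieProd_lieProd_le.trans (sup_le ?_ (lieProd_mono le_rfl ih))
    exact lieProd_mono (lieProd_mono le_rfl hV.lieProd_le_self) le_rfl

end GradedFamily

theorem listLie_mem (h : lieProd V W ≤ W) {a : A} {z : L} (hz : z ∈ W a) (l : List (A × L))
    (hl : ∀ p ∈ l, p.2 ∈ V p.1) : listLie l z ∈ W ((l.map Prod.fst).prod * a) := by
  induction l with
  | nil => simpa using hz
  | cons p l ih =>
    rw [listLie_cons]
    refine h _ (lie_mem_lieProd (hl p (by simp)) (ih fun q hq => hl q (by simp [hq])) ?_)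
    simp [mul_assoc]

/-- Swapping two adjacent operators costs one bracket by an element of `[V, V]`, which carries `Γ`
into `Γ'`. -/
theorem listLie_sub_mem_of_perm {Γ Γ' : A → Submodule K L} (hΓ : lieProd V Γ ≤ Γ)
    (hΓ' : lieProd V Γ' ≤ Γ') (hVV : lieProd (lieProd V V) Γ ≤ Γ') {a : A} {z : L} (hz : z ∈ Γ a)
    {l l' : List (A × L)} (hl : ∀ p ∈ l, p.2 ∈ V p.1) (h : l.Perm l') :
    listLie l z - listLie l' z ∈ Γ' ((l.map Prod.fst).prod * a) := by
  induction h with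
  | nil => simp
  | cons p _ ih =>
    rw [listLie_cons, listLie_cons, ← lie_sub]
    refine hΓ' _ (lie_mem_lieProd (hl p (by simp)) (ih fun q hq => hl q (by simp [hq])) ?_)
    simp [mul_assoc]
  | swap p q l =>
    simp only [listLie_cons]
    have : ⁅q.2, ⁅p.2, listLie l z⁆⁆ - ⁅p.2, ⁅q.2, listLie l z⁆⁆ = ⁅⁅q.2, p.2⁆, listLie l z⁆ := by
      rw [leibniz_lie]; abel
    rw [this]
    have hm := listLie_mem hΓ hz l fun r hr => hl r (by simp [hr])
    refine hVV _ (lie_mem_lieProd (lie_mem_lieProd (hl q (by simp)) (hl p (by simp)) rfl) hm ?_)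
    simp [mul_assoc]
  | trans h₁ _ ih₁ ih₂ =>
    have h₃ := ih₂ fun p hp => hl p (h₁.mem_iff.2 hp)
    rw [(h₁.map Prod.fst).prod_eq.symm] at h₃
    simpa using add_mem (ih₁ hl) h₃

namespace GradedFamily

/-- Reorder the operators, modulo `Γ'`, so that those indexed by the escaping set `I` act first.
They send `z` to a degree outside `X`, so the reordered bracket vanishes. -/
theorem listLie_mem_of_escapesIn (hV : GradedFamily X V) {d : ℕ} (hd : EscapesIn X d)
    {Γ Γ' : A → Submodule K L} (hΓV : Γ ≤ V) (hΓ : lieProd V Γ ≤ Γ)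
    (hΓ' : lieProd V Γ' ≤ Γ') (hVV : lieProd (lieProd V V) Γ ≤ Γ') {a : A} {z : L} (hz : z ∈ Γ a)
    (l : List (A × L)) (hl : ∀ p ∈ l, p.2 ∈ V p.1) (hld : l.length = d) :
    listLie l z ∈ Γ' ((l.map Prod.fst).prod * a) := by
  classical
  by_cases h0 : ∃ p ∈ l, p.2 = 0
  · obtain ⟨p, hp, h0⟩ := h0
    obtain ⟨s, t, rfl⟩ := List.append_of_mem hp
    rw [listLie_append, listLie_cons, h0, zero_lie, listLie_zero]
    exact zero_mem _
  by_cases hz0 : z = 0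
  · rw [hz0, listLie_zero]
    exact zero_mem _
  push Not at h0
  subst hld
  obtain ⟨I, hI⟩ := hd a (hV.mem_support (hΓV a hz) hz0) (fun i => (l.get i).1)
    fun i => hV.mem_support (hl _ (l.get_mem i)) (h0 _ (l.get_mem i))
  set f : List (Fin l.length) → List (A × L) := List.map l.get
  set s := (List.finRange l.length).filter (· ∉ I)
  set t := (List.finRange l.length).filter (· ∈ I)
  have hperm : l.Perm (f s ++ f t) := by
    have h₁ : (s ++ t).Perm (List.finRange l.length) := by
      have := List.filter_append_perm (fun i => decide (i ∉ I)) (List.finRange l.length)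
      simpa [s, t] using this
    have h₂ := h₁.map l.get
    rw [List.map_append] at h₂
    have h₃ : (List.finRange l.length).map l.get = l := by simp
    rw [h₃] at h₂
    exact h₂.symm
  have ht : listLie (f t) z = 0 := by
    have hm := listLie_mem (W := V) hV.lieProd_le_self (hΓV a hz) (f t) fun p hp => by
      obtain ⟨i, -, rfl⟩ := List.mem_map.1 hp
      exact hl _ (l.get_mem i)
    refine hV.eq_zero hm ?_
    have : (((f t).map Prod.fst).prod) = ∏ i ∈ I, (l.get i).1 := by
      rw [List.map_map]
      have hn : t.Nodup := (List.nodup_finRange _).filter _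
      have hI : t.toFinset = I := by ext i; simp [t]
      rw [← hI, List.prod_toFinset _ hn]
      rfl
    rwa [this, mul_comm]
  have := listLie_sub_mem_of_perm hΓ hΓ' hVV hz hl hperm
  rwa [listLie_append, ht, listLie_zero, sub_zero] at this

end GradedFamily

theorem iterate_lieProd_le (Γ : A → Submodule K L) (n : ℕ) :
    (lieProd V)^[n] Γ ≤ fun g => Submodule.span K {w | ∃ a, ∃ z ∈ Γ a, ∃ l : List (A × L),
      (∀ p ∈ l, p.2 ∈ V p.1) ∧ l.length = n ∧ (l.map Prod.fst).prod * a = g ∧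
        listLie l z = w} := by
  induction n with
  | zero =>
    intro g z hz
    exact Submodule.subset_span ⟨g, z, hz, [], by simp, rfl, by simp, rfl⟩
  | succ n ih =>
    rw [Function.iterate_succ_apply']
    refine lieProd_le fun u v x hx y hy => ?_
    rw [← LieModule.toEnd_apply_apply K, ← Submodule.mem_comap]
    refine Submodule.span_le.2 ?_ (ih v hy)
    rintro _ ⟨a, z, hz, l, hl, rfl, rfl, rfl⟩
    refine Submodule.subset_span ⟨a, z, hz, (u, x) :: l, ?_, rfl, by simp [mul_assoc], rfl⟩
    simpa [hx] using hl

namespace GradedFamily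

theorem lowerCentralFamily_eq_bot (hV : GradedFamily X V) {d : ℕ} (hd : EscapesIn X d) (n : ℕ)
    (hn : _root_.derivedFamily V n = ⊥) :
    lowerCentralFamily V (∑ i ∈ Finset.range n, d ^ i) = ⊥ := by
  induction n generalizing V with
  | zero => exact hn
  | succ n ih =>
    set c := ∑ i ∈ Finset.range n, d ^ i
    set Γ := lowerCentralFamily (lieProd V V)
    have hΓc : Γ c = ⊥ := ih hV.lieProd_self (by rwa [derivedFamily_succ'] at hn)
    have hΓ := hV.lieProd_lowerCentralFamily_le
    have hstep (i : ℕ) : (lieProd V)^[d] (Γ i) ≤ Γ (i + 1) := by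
      refine (iterate_lieProd_le _ d).trans fun g => Submodule.span_le.2 ?_
      rintro _ ⟨a, z, hz, l, hl, hld, rfl, rfl⟩
      refine hV.listLie_mem_of_escapesIn hd ?_ (hΓ i) (hΓ (i + 1)) ?_ hz l hl hld
      · exact (hV.lieProd_self.lowerCentralFamily_antitone (Nat.zero_le i)).trans
          hV.lieProd_le_self
      · exact (lowerCentralFamily_succ i).ge
    have hmono (m : ℕ) : Monotone (lieProd V)^[m] :=
      Monotone.iterate (fun _ _ h => lieProd_mono le_rfl h) m
    have hiter (i : ℕ) : lowerCentralFamily V (d * i + 1) ≤ Γ i := by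
      induction i with
      | zero => exact le_rfl
      | succ i ih =>
        have h : d * (i + 1) + 1 = d + (d * i + 1) := by ring
        rw [h, lowerCentralFamily, Function.iterate_add_apply]
        exact (hmono d ih).trans (hstep i)
    -- The new sum is `d * c + 1`; the extra `1` is the bracket that enters `[V, V]`.
    rw [geom_sum_succ, ← le_bot_iff, ← hΓc]
    exact hiter c

end GradedFamily

end Class

/-! ### Subalgebras generated by homogeneous components -/

/-- Left-normed products of elements of the `V w` with `w ∈ J`, together with their degree. -/
inductive IsLeftNormed {A K L : Type*} [Group A] [CommRing K] [LieRing L] [LieAlgebra K L]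
    (V : A → Submodule K L) (J : Set A) : A → L → Prop
  | base {g : A} {x : L} : g ∈ J → x ∈ V g → IsLeftNormed V J g x
  | cons {g w t : A} {x z : L} : w ∈ J → x ∈ V w → IsLeftNormed V J t z → w * t = g →
      IsLeftNormed V J g ⁅x, z⁆

/-- The components of the subalgebra generated by the `V w` with `w ∈ J`. -/
def genFamily {A K L : Type*} [Group A] [CommRing K] [LieRing L] [LieAlgebra K L]
    (V : A → Submodule K L) (J : Set A) (g : A) : Submodule K L :=
  Submodule.span K {z | IsLeftNormed V J g z}

section Gen

variable {A K L : Type*} [CommGroup A] [CommRing K] [LieRing L] [LieAlgebra K L]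
  {V W F : A → Submodule K L} {X J J' : Set A}

theorem mem_genFamily {g : A} {x : L} (hg : g ∈ J) (hx : x ∈ V g) : x ∈ genFamily V J g :=
  Submodule.subset_span (.base hg hx)

theorem lie_mem_genFamily_of_mem {g w t : A} {x z : L} (hw : w ∈ J) (hx : x ∈ V w)
    (hz : z ∈ genFamily V J t) (h : w * t = g) : ⁅x, z⁆ ∈ genFamily V J g := by
  have : genFamily V J t ≤ (genFamily V J g).comap (LieModule.toEnd K L L x) :=
    Submodule.span_le.2 fun z hz => Submodule.subset_span (.cons hw hx hz h)
  exact this hz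

/-- By Jacobi, a bracket inside the generated subalgebra is a combination of brackets whose left
factor is a single generator. So only these need testing, in the same total degree. -/
theorem lie_mem_of_mem_genFamily {g u v : A} {x y : L} {P : Submodule K L}
    (hP : ∀ w ∈ J, ∀ t, w * t = g → ∀ x ∈ V w, ∀ z ∈ genFamily V J t, ⁅x, z⁆ ∈ P)
    (hx : x ∈ genFamily V J u) (hy : y ∈ genFamily V J v) (h : u * v = g) : ⁅x, y⁆ ∈ P := by
  have key : ∀ u x, IsLeftNormed V J u x → ∀ v, ∀ y ∈ genFamily V J v, ∀ g, u * v = g →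
      ∀ P : Submodule K L, (∀ w ∈ J, ∀ t, w * t = g → ∀ x ∈ V w, ∀ z ∈ genFamily V J t,
        ⁅x, z⁆ ∈ P) → ⁅x, y⁆ ∈ P := by
    intro u x hx
    induction hx with
    | base hw hx =>
      intro v y hy g h P hP
      exact hP _ hw v h _ hx y hy
    | @cons g₀ w t x z hw hx _ hwt ih =>
      intro v y hy g h P hP
      rw [lie_lie]
      refine sub_mem (hP w hw (t * v) (by rw [← h, ← hwt, mul_assoc]) x hx _ ?_) ?_
      -- The induction hypothesis is used here with the generated subalgebra itself as `P`, to see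
      -- that `⁅z, y⁆` belongs to it.
      · refine ih v y hy _ rfl _ fun w hw s hs x hx z hz => lie_mem_genFamily_of_mem hw hx hz hs
      · refine ih (w * v) _ (lie_mem_genFamily_of_mem hw hx hy rfl) g ?_ P hP
        rw [← h, ← hwt, mul_left_comm, mul_assoc]
  induction hx using Submodule.span_induction with
  | mem x hx => exact key u x hx v y hy g h P hP
  | zero => rw [zero_lie]; exact zero_mem _
  | add x₁ x₂ _ _ h₁ h₂ => rw [add_lie]; exact add_mem h₁ h₂
  | smul c x _ h => rw [smul_lie]; exact P.smul_mem c h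

theorem lie_mem_genFamily {u v : A} {x y : L}
    (hx : x ∈ genFamily V J u) (hy : y ∈ genFamily V J v) : ⁅x, y⁆ ∈ genFamily V J (u * v) :=
  lie_mem_of_mem_genFamily (fun _ hw _ ht _ hx _ hz => lie_mem_genFamily_of_mem hw hx hz ht)
    hx hy rfl

theorem genFamily_le (hF : ∀ u v x y, x ∈ F u → y ∈ F v → ⁅x, y⁆ ∈ F (u * v))
    (h : ∀ w ∈ J, V w ≤ F w) : genFamily V J ≤ F := by
  refine fun g => Submodule.span_le.2 fun z hz => ?_
  induction hz with
  | base hg hx => exact h _ hg hx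
  | cons hw hx _ hg ih => rw [← hg]; exact hF _ _ _ _ (h _ hw hx) ih

theorem GradedFamily.genFamily_le (hV : GradedFamily X V) : genFamily V J ≤ V :=
  _root_.genFamily_le (fun _ _ _ _ hx hy => hV.lie_mem hx hy) fun _ _ => le_rfl

/-! ### Good orderings and elimination of low ranks -/

/-- An injective ranking of the elements of `X` by `1, …, k` which is a good ordering. -/
structure IsRanking (X : Set A) (k : ℕ) (r : A → ℕ) : Prop where
  one_notMem : (1 : A) ∉ X
  one_le : ∀ ⦃g⦄, g ∈ X → 1 ≤ r g
  le : ∀ ⦃g⦄, g ∈ X → r g ≤ k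
  inj : Set.InjOn r X
  good : ∀ ⦃u v⦄, u ∈ X → v ∈ X → u * v ∈ X → ¬ (r u < r (u * v) ∧ r (u * v) < r v)

/-- The elements of `X` of rank larger than `j`. -/
def above (X : Set A) (r : A → ℕ) (j : ℕ) : Set A := {g ∈ X | j < r g}

namespace IsRanking

variable {k : ℕ} {r : A → ℕ}

theorem reverse (hr : IsRanking X k r) : IsRanking X k (fun g => k + 1 - r g) where
  one_notMem := hr.one_notMem
  one_le g hg := by have := hr.le hg; omega
  le g hg := by have := hr.one_le hg; omega
  inj g hg h hh H := hr.inj hg hh (by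
    have := hr.le hg; have := hr.le hh; dsimp only at H; omega)
  good u v hu hv huv := by
    have := hr.good hv hu (by rwa [mul_comm])
    rw [mul_comm v u] at this
    have := hr.le hu; have := hr.le hv; have := hr.le huv
    omega

/-- Equality of ranks would put `1` in `X`. By commutativity, goodness applies to `u, v` in both
orders and excludes a rank strictly between. -/
theorem lt_or_lt (hr : IsRanking X k r) {u v : A} (hu : u ∈ X) (hv : v ∈ X) (huv : u * v ∈ X) :
    (r (u * v) < r u ∧ r (u * v) < r v) ∨ (r u < r (u * v) ∧ r v < r (u * v)) := by
  have h₁ : r u ≠ r (u * v) := fun h => hr.one_notMem <| by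
    rwa [← left_eq_mul.1 (hr.inj hu huv h)]
  have h₂ : r v ≠ r (u * v) := fun h => hr.one_notMem <| by
    rwa [← right_eq_mul.1 (hr.inj hv huv h)]
  have h₃ := hr.good hu hv huv
  have h₄ := hr.good hv hu (by rwa [mul_comm])
  rw [mul_comm v u] at h₄
  omega

/-- Write the bracket with a generator of degree `w` on the left, the other factor having degree
`t`. Since `r w ≥ j + 1 = r (w * t)`, the dichotomy `lt_or_lt` forces both `w` and `t` to have rank
above `j + 1`. -/
theorem lie_mem_genFamily_above (hr : IsRanking X k r) (hV : GradedFamily X V) {j : ℕ} {u v : A}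
    {x y : L} (hx : x ∈ genFamily V (above X r j) u) (hy : y ∈ genFamily V (above X r j) v)
    (huv : u * v ∈ X) (hj : r (u * v) = j + 1) :
    ⁅x, y⁆ ∈ genFamily V (above X r (j + 1)) (u * v) := by
  refine lie_mem_of_mem_genFamily ?_ hx hy rfl
  rintro w ⟨hw, hjw⟩ t hwt x hx z hz
  have hz' := hV.genFamily_le t hz
  by_cases hz0 : z = 0
  · rw [hz0, lie_zero]; exact zero_mem _
  have ht := hV.mem_support hz' hz0
  rw [← hwt] at huv hj
  have := hr.lt_or_lt hw ht huv
  rw [← hwt]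
  exact lie_mem_genFamily (mem_genFamily ⟨hw, by omega⟩ hx) (mem_genFamily ⟨ht, by omega⟩ hz')

/-- To raise the threshold past rank `i + 1`, `2 ^ i` derived steps suffice in that degree: a
bracket landing there has factors both of higher rank, or both of lower rank and already expressed
by generators above `i`. Lower degrees apply induction to the family `derivedFamily V (2 ^ i)`,
whose rank `i + 1` generators can then be replaced. -/
theorem derivedFamily_le_genFamily (hr : IsRanking X k r) (i : ℕ) :
    ∀ (V : A → Submodule K L), GradedFamily X V → ∀ g ∈ X, r g ≤ i →
      derivedFamily V (2 ^ i - 2 ^ (r g - 1)) g ≤ genFamily V (above X r i) g := by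
  induction i with
  | zero =>
    intro V _ g hg h
    have := hr.one_le hg
    omega
  | succ i ih =>
    have top (V : A → Submodule K L) (hV : GradedFamily X V) (g : A) (hg : g ∈ X)
        (hi : r g = i + 1) : derivedFamily V (2 ^ i) g ≤ genFamily V (above X r (i + 1)) g := by
      obtain ⟨m, hm⟩ : ∃ m, 2 ^ i = m + 1 := ⟨2 ^ i - 1, by have := Nat.one_le_two_pow (n := i); omega⟩
      rw [hm, derivedFamily_succ]
      refine lieProd_apply_le ?_
      rintro u v rfl x hx y hy
      by_cases hx0 : x = 0
      · rw [hx0, zero_lie]; exact zero_mem _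
      by_cases hy0 : y = 0
      · rw [hy0, lie_zero]; exact zero_mem _
      have hu := (hV.derivedFamily m).mem_support hx hx0
      have hv := (hV.derivedFamily m).mem_support hy hy0
      obtain ⟨h₁, h₂⟩ | ⟨h₁, h₂⟩ := hr.lt_or_lt hu hv hg
      · exact lie_mem_genFamily (mem_genFamily ⟨hu, by omega⟩ (hV.derivedFamily_le m u hx))
          (mem_genFamily ⟨hv, by omega⟩ (hV.derivedFamily_le m v hy))
      · have low (w : A) (hw : w ∈ X) (hwi : r w ≤ i) :
            derivedFamily V m w ≤ genFamily V (above X r i) w := by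
          refine (hV.derivedFamily_antitone ?_ w).trans (ih V hV w hw hwi)
          have := Nat.one_le_two_pow (n := r w - 1)
          omega
        exact hr.lie_mem_genFamily_above hV (low u hu (by omega) hx) (low v hv (by omega) hy) hg hi
    intro V hV g hg hgi
    obtain h | h := hgi.eq_or_lt
    · rw [h, Nat.add_sub_cancel, pow_succ, mul_two, Nat.add_sub_cancel]
      exact top V hV g hg h
    · have h' : r g ≤ i := by omega
      have hle : 2 ^ (r g - 1) ≤ 2 ^ i := Nat.pow_le_pow_right (by norm_num) (by omega)
      have : 2 ^ (i + 1) - 2 ^ (r g - 1) = (2 ^ i - 2 ^ (r g - 1)) + 2 ^ i := by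
        rw [pow_succ]; omega
      rw [this, derivedFamily_add]
      have hle := genFamily_le (V := derivedFamily V (2 ^ i)) (J := above X r i)
        (F := genFamily V (above X r (i + 1)))
        (fun _ _ _ _ hx hy => lie_mem_genFamily hx hy) ?_ g
      · exact (ih _ (hV.derivedFamily _) g hg h').trans hle
      rintro w ⟨hw, hwi⟩
      obtain h | h : r w = i + 1 ∨ i + 1 < r w := by omega
      · exact top V hV w hw h
      · exact fun x hx => mem_genFamily ⟨hw, h⟩ (hV.derivedFamily_le _ w hx)

end IsRanking

end Gen

/-! ### Bounding the derived length -/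

section Solvable

variable {A K L : Type*} [CommGroup A] [CommRing K] [LieRing L] [LieAlgebra K L]
  {V : A → Submodule K L} {X J J' : Set A}

theorem lie_eq_zero_of_mem_genFamily_left {g : A} {x y : L}
    (h : ∀ w ∈ J, ∀ z ∈ V w, ⁅z, y⁆ = 0) (hx : x ∈ genFamily V J g) : ⁅x, y⁆ = 0 := by
  induction hx using Submodule.span_induction with
  | mem x hx =>
    induction hx with
    | base hw hx => exact h _ hw _ hx
    | cons hw hx _ _ ih => rw [lie_lie, ih, h _ hw _ hx, lie_zero, lie_zero, sub_zero]
  | zero => exact zero_lie _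
  | add x₁ x₂ _ _ h₁ h₂ => rw [add_lie, h₁, h₂, add_zero]
  | smul c x _ h => rw [smul_lie, h, smul_zero]

theorem lie_eq_zero_of_mem_genFamily {u v : A} {x y : L}
    (h : ∀ s ∈ J, ∀ t ∈ J', ∀ x ∈ V s, ∀ y ∈ V t, ⁅x, y⁆ = 0)
    (hx : x ∈ genFamily V J u) (hy : y ∈ genFamily V J' v) : ⁅x, y⁆ = 0 := by
  refine lie_eq_zero_of_mem_genFamily_left (fun s hs z hz => ?_) hx
  rw [← lie_skew, neg_eq_zero]
  refine lie_eq_zero_of_mem_genFamily_left (fun t ht w hw => ?_) hy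
  rw [← lie_skew, neg_eq_zero]
  exact h s hs t ht z hz w hw

/-- The components of the subalgebra generated by the component of highest rank. -/
abbrev topFamily (V : A → Submodule K L) (X : Set A) (k : ℕ) (r : A → ℕ) : A → Submodule K L :=
  genFamily V (above X r (k - 1))

/-- The components of the subalgebra generated by the component of lowest rank. -/
abbrev bottomFamily (V : A → Submodule K L) (X : Set A) (k : ℕ) (r : A → ℕ) :
    A → Submodule K L :=
  topFamily V X k fun g => k + 1 - r g

namespace IsRanking

variable {k : ℕ} {r : A → ℕ}

theorem lie_top_bottom (hr : IsRanking X k r) (hV : GradedFamily X V) {b c : A} (hb : b ∈ X)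
    (hc : c ∈ X) (hbk : r b = k) (hc1 : r c = 1) {x y : L} (hx : x ∈ V b) (hy : y ∈ V c) :
    ⁅x, y⁆ = 0 := by
  refine hV.lie_eq_zero hx hy fun h => ?_
  have := hr.one_le h
  have := hr.le h
  have := hr.lt_or_lt hb hc h
  omega

theorem mem_topFamily {g : A} (hg : g ∈ X) (hgk : r g = k) (hk : 1 ≤ k) {x : L}
    (hx : x ∈ V g) : x ∈ topFamily V X k r g :=
  mem_genFamily ⟨hg, by omega⟩ hx

theorem mem_bottomFamily {g : A} (hg : g ∈ X) (hg1 : r g = 1) (hk : 1 ≤ k) {x : L}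
    (hx : x ∈ V g) : x ∈ bottomFamily V X k r g :=
  mem_genFamily ⟨hg, by dsimp only; omega⟩ hx

theorem lie_topFamily_bottomFamily (hr : IsRanking X k r) (hV : GradedFamily X V) {u v : A}
    {x y : L} (hx : x ∈ topFamily V X k r u) (hy : y ∈ bottomFamily V X k r v) : ⁅x, y⁆ = 0 := by
  refine lie_eq_zero_of_mem_genFamily ?_ hx hy
  rintro s ⟨hs, hs'⟩ t ⟨ht, ht'⟩ x hx y hy
  have := hr.le hs
  have := hr.one_le ht
  dsimp only at ht'
  exact hr.lie_top_bottom hV hs ht (by omega) (by omega) hx hy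

theorem lie_bottomFamily_topFamily (hr : IsRanking X k r) (hV : GradedFamily X V) {u v : A}
    {x y : L} (hx : x ∈ bottomFamily V X k r u) (hy : y ∈ topFamily V X k r v) : ⁅x, y⁆ = 0 := by
  rw [← lie_skew, hr.lie_topFamily_bottomFamily hV hy hx, neg_zero]

/-- A left-normed expression in the top degree must begin with a top generator, leaving a factor of
degree `1`, which is zero as `1 ∉ X`. -/
theorem lie_topFamily_topFamily (hr : IsRanking X k r) (hV : GradedFamily X V) {u v : A}
    {x y : L} (hx : x ∈ topFamily V X k r u) (hy : y ∈ topFamily V X k r v) (huv : u * v ∈ X)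
    (hk : r (u * v) = k) : ⁅x, y⁆ = 0 := by
  rw [← Submodule.mem_bot K]
  refine lie_mem_of_mem_genFamily ?_ hx hy rfl
  rintro w ⟨hw, hw'⟩ t ht x hx z hz
  have := hr.le hw
  have hwu : w = u * v := hr.inj hw huv (by omega)
  have ht1 : t = 1 := by rwa [← hwu, mul_eq_left] at ht
  subst ht1
  rw [hV.eq_zero (hV.genFamily_le 1 hz) hr.one_notMem, lie_zero]
  exact zero_mem _

theorem lie_lie_eq_zero (hr : IsRanking X k r) (hV : GradedFamily X V) (hk : 1 ≤ k) {u v : A}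
    {x y z : L} (huv : u * v ∈ X) (huvk : r (u * v) = k) (hx : x ∈ V (u * v))
    (hy : y ∈ topFamily V X k r u ∨ y ∈ bottomFamily V X k r u)
    (hz : z ∈ topFamily V X k r v ∨ z ∈ bottomFamily V X k r v) : ⁅x, ⁅y, z⁆⁆ = 0 := by
  obtain hy | hy := hy <;> obtain hz | hz := hz
  · rw [hr.lie_topFamily_topFamily hV hy hz huv huvk, lie_zero]
  · rw [hr.lie_topFamily_bottomFamily hV hy hz, lie_zero]
  · rw [hr.lie_bottomFamily_topFamily hV hy hz, lie_zero]
  · exact hr.lie_topFamily_bottomFamily hV (mem_topFamily huv huvk hk hx) (lie_mem_genFamily hy hz)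

theorem derivedFamily_le_topFamily (hr : IsRanking X k r) (hV : GradedFamily X V) {g : A} {m : ℕ}
    (hg : g ∈ X) (hgk : r g < k) (hm : 2 ^ (k - 1) - 2 ^ (r g - 1) ≤ m) :
    derivedFamily V m g ≤ topFamily V X k r g :=
  (hV.derivedFamily_antitone hm g).trans
    (hr.derivedFamily_le_genFamily (k - 1) V hV g hg (by omega))

theorem derivedFamily_le_bottomFamily (hr : IsRanking X k r) (hV : GradedFamily X V) {g : A}
    {m : ℕ} (hg : g ∈ X) (hgk : 1 < r g) (hm : 2 ^ (k - 1) - 2 ^ (k - r g) ≤ m) :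
    derivedFamily V m g ≤ bottomFamily V X k r g := by
  have := hr.le hg
  refine hr.reverse.derivedFamily_le_topFamily hV hg (by omega) ?_
  have h : k + 1 - r g - 1 = k - r g := by omega
  rwa [h]

/-- One derived step earlier, rank 1 and 2 components lie in the bottom subalgebra and ranks 3 to `k
- 1` in the top one. The requirement `k ≥ 4` is what makes this true of rank 2, where `2 ^ (k - 2) ≥
4` is needed. -/
theorem lie_top_derivedFamily_of_four_le (hr : IsRanking X k r) (hV : GradedFamily X V)
    (hk : 4 ≤ k) {b : A} (hb : b ∈ X) (hbk : r b = k) {x y : L} (hx : x ∈ V b)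
    (hy : y ∈ derivedFamily V (2 ^ (k - 1) - 2) b) : ⁅x, y⁆ = 0 := by
  have h8 : 2 ^ 3 ≤ 2 ^ (k - 1) := Nat.pow_le_pow_right (by norm_num) (by omega)
  have hm : 2 ^ (k - 1) - 2 = (2 ^ (k - 1) - 3) + 1 := by omega
  have h4 (n : ℕ) (hn : 2 ≤ n) : 2 ^ (k - 1) - 2 ^ n ≤ 2 ^ (k - 1) - 3 := by
    have : 2 ^ 2 ≤ 2 ^ n := Nat.pow_le_pow_right (by norm_num) hn
    omega
  have key (u : A) (hu : u ∈ X) (huk : r u < k) (z : L)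
      (hz : z ∈ derivedFamily V (2 ^ (k - 1) - 3) u) :
      z ∈ topFamily V X k r u ∨ z ∈ bottomFamily V X k r u := by
    have := hr.one_le hu
    obtain h | h | h : r u = 1 ∨ r u = 2 ∨ 3 ≤ r u := by omega
    · exact .inr (mem_bottomFamily hu h (by omega) (hV.derivedFamily_le _ u hz))
    · exact .inr (hr.derivedFamily_le_bottomFamily hV hu (by omega) (h4 _ (by omega)) hz)
    · exact .inl (hr.derivedFamily_le_topFamily hV hu huk (h4 _ (by omega)) hz)
  rw [← Submodule.mem_bot K]
  rw [hm, derivedFamily_succ] at hy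
  refine lie_right_mem_of_lieProd ?_ hy
  rintro u v rfl y hy z hz
  rw [Submodule.mem_bot]
  by_cases hy0 : y = 0
  · rw [hy0, zero_lie, lie_zero]
  by_cases hz0 : z = 0
  · rw [hz0, lie_zero, lie_zero]
  have hu := (hV.derivedFamily _).mem_support hy hy0
  have hv := (hV.derivedFamily _).mem_support hz hz0
  have := hr.le hu
  have := hr.lt_or_lt hu hv hb
  exact hr.lie_lie_eq_zero hV (by omega) hb hbk hx (key u hu (by omega) y hy)
    (key v hv (by omega) z hz)

/-- Were `c * a * a` in `X`, its rank would be below that of `a`, hence 1, so it would equal `c`.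
Then `a * a = 1`, against freeness. -/
theorem lie_lie_eq_zero_of_mul_eq {k : ℕ} {r : A → ℕ} (hr : IsRanking X k r)
    (hV : GradedFamily X V) (hk : k = 3)
    (hfree : ∀ x ∈ X, ∀ y ∈ X, y * y = 1 → x * y ∉ X) {a c : A} (ha : a ∈ X) (hc : c ∈ X)
    (hca : c * a ∈ X) (ha2 : r a = 2) (hc1 : r c = 1) (hb : r (c * a) = k) {x y z : L}
    (hx : x ∈ V (c * a)) (hy : y ∈ V c) (hz : z ∈ V a) : ⁅x, ⁅y, z⁆⁆ = 0 := by
  rw [leibniz_lie, hr.lie_top_bottom hV hca hc hb hc1 hx hy, zero_lie, zero_add,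
    hV.lie_eq_zero hx hz, lie_zero]
  intro h
  have h₁ := hr.one_le h
  have h₂ := hr.le h
  have := hr.lt_or_lt hca ha h
  have h₃ : c * a * a = c := hr.inj h hc (by omega)
  rw [mul_assoc, mul_eq_left] at h₃
  exact hfree c hc a ha h₃ hca

theorem lie_top_derivedFamily_of_eq_three (hr : IsRanking X k r) (hV : GradedFamily X V)
    (hk : k = 3) (hfree : ∀ x ∈ X, ∀ y ∈ X, y * y = 1 → x * y ∉ X) {b : A} (hb : b ∈ X)
    (hbk : r b = k) {x y : L} (hx : x ∈ V b) (hy : y ∈ derivedFamily V 2 b) : ⁅x, y⁆ = 0 := by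
  rw [← Submodule.mem_bot K]
  rw [derivedFamily_succ] at hy
  refine lie_right_mem_of_lieProd ?_ hy
  clear hy y
  rintro u v rfl y hy z hz
  replace hy := hV.derivedFamily_le _ u hy
  replace hz := hV.derivedFamily_le _ v hz
  rw [Submodule.mem_bot]
  by_cases hy0 : y = 0
  · rw [hy0, zero_lie, lie_zero]
  by_cases hz0 : z = 0
  · rw [hz0, lie_zero, lie_zero]
  have hu := hV.mem_support hy hy0
  have hv := hV.mem_support hz hz0
  have hu1 := hr.one_le hu
  have hv1 := hr.one_le hv
  have := hr.le hu
  have := hr.lt_or_lt hu hv hb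
  obtain hu' | hu' : r u = 1 ∨ r u = 2 := by omega
  · obtain hv' | hv' : r v = 1 ∨ r v = 2 := by omega
    · exact hr.lie_lie_eq_zero hV (by omega) hb hbk hx (.inr (mem_bottomFamily hu hu' (by omega) hy))
        (.inr (mem_bottomFamily hv hv' (by omega) hz))
    · exact hr.lie_lie_eq_zero_of_mul_eq hV hk hfree hv hu hb hv' hu' hbk hx hy hz
  · obtain hv' | hv' : r v = 1 ∨ r v = 2 := by omega
    · rw [mul_comm] at hx hb hbk
      rw [← lie_skew y z, lie_neg,
        hr.lie_lie_eq_zero_of_mul_eq hV hk hfree hu hv hb hu' hv' hbk hx hz hy, neg_zero]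
    -- Here the top degree is `u ^ 2`. If `u ^ 3 ∈ X`, it has rank 1; then `u ^ 4 ∈ X` would need
    -- rank below 3 as a square of `u ^ 2`, but rank 3 as `u ^ 3 * u`.
    · obtain rfl : u = v := hr.inj hu hv (by omega)
      by_cases h3 : u * u * u ∈ X
      · refine hV.lie_eq_zero hx (hV.lie_mem hy hz) fun h4 => ?_
        have h₁ := hr.lt_or_lt hb hu h3
        have h₂ := hr.lt_or_lt hb hb h4
        rw [← mul_assoc] at h4 h₂
        have h₃ := hr.lt_or_lt h3 hu h4
        have := hr.one_le h4
        have := hr.le h3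
        have := hr.le h4
        omega
      · rw [leibniz_lie, hV.lie_eq_zero hx hy h3, hV.lie_eq_zero hx hz h3, zero_lie, lie_zero,
          add_zero]

/-- One step before the end, degrees of rank above 1 lie in the top subalgebra and those of rank
below `k` in the bottom one. Commutation kills every bracket except those with both factors of rank
1 or both of rank `k`; these pairs share one degree and are killed by `htop`, for the order or its
reverse. -/
theorem derivedFamily_eq_bot (hr : IsRanking X k r) (hV : GradedFamily X V) (hk : 3 ≤ k)
    (hfree : ∀ x ∈ X, ∀ y ∈ X, y * y = 1 → x * y ∉ X) :
    derivedFamily V (2 ^ (k - 1) - 1) = ⊥ := by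
  have h4 : 2 ^ 2 ≤ 2 ^ (k - 1) := Nat.pow_le_pow_right (by norm_num) (by omega)
  have hm : 2 ^ (k - 1) - 1 = (2 ^ (k - 1) - 2) + 1 := by omega
  have htop (r : A → ℕ) (hr : IsRanking X k r) (b : A) (hb : b ∈ X) (hbk : r b = k) (x y : L)
      (hx : x ∈ derivedFamily V (2 ^ (k - 1) - 2) b)
      (hy : y ∈ derivedFamily V (2 ^ (k - 1) - 2) b) : ⁅x, y⁆ = 0 := by
    replace hx := hV.derivedFamily_le _ b hx
    obtain rfl | h : k = 3 ∨ 4 ≤ k := by omega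
    · exact hr.lie_top_derivedFamily_of_eq_three hV rfl hfree hb hbk hx hy
    · exact hr.lie_top_derivedFamily_of_four_le hV h hb hbk hx hy
  have h2 (n : ℕ) (hn : 1 ≤ n) : 2 ^ (k - 1) - 2 ^ n ≤ 2 ^ (k - 1) - 2 := by
    have : 2 ^ 1 ≤ 2 ^ n := Nat.pow_le_pow_right (by norm_num) hn
    omega
  have hB (u : A) (hu : u ∈ X) (h : 1 < r u) (x : L)
      (hx : x ∈ derivedFamily V (2 ^ (k - 1) - 2) u) : x ∈ topFamily V X k r u := by
    obtain h' | h' := (hr.le hu).eq_or_lt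
    · exact mem_topFamily hu h' (by omega) (hV.derivedFamily_le _ u hx)
    · exact hr.derivedFamily_le_topFamily hV hu h' (h2 _ (by omega)) hx
  have hC (u : A) (hu : u ∈ X) (h : r u < k) (x : L)
      (hx : x ∈ derivedFamily V (2 ^ (k - 1) - 2) u) : x ∈ bottomFamily V X k r u := by
    obtain h' | h' := (hr.one_le hu).eq_or_lt
    · exact mem_bottomFamily hu h'.symm (by omega) (hV.derivedFamily_le _ u hx)
    · exact hr.derivedFamily_le_bottomFamily hV hu h' (h2 _ (by omega)) hx
  rw [hm, derivedFamily_succ, ← le_bot_iff]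
  refine lieProd_le fun u v x hx y hy => ?_
  rw [Pi.bot_apply, Submodule.mem_bot]
  by_cases hx0 : x = 0
  · rw [hx0, zero_lie]
  by_cases hy0 : y = 0
  · rw [hy0, lie_zero]
  have hu := (hV.derivedFamily _).mem_support hx hx0
  have hv := (hV.derivedFamily _).mem_support hy hy0
  have := hr.one_le hu
  have := hr.one_le hv
  have := hr.le hu
  have := hr.le hv
  obtain h | h | h | h : (r u = 1 ∧ r v = 1) ∨ (r u = k ∧ r v = k) ∨ (1 < r u ∧ r v < k) ∨
    (r u < k ∧ 1 < r v) := by omega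
  · obtain rfl : u = v := hr.inj hu hv (h.1.trans h.2.symm)
    exact htop _ hr.reverse u hu (by omega) x y hx hy
  · obtain rfl : u = v := hr.inj hu hv (h.1.trans h.2.symm)
    exact htop r hr u hu h.1 x y hx hy
  · exact hr.lie_topFamily_bottomFamily hV (hB u hu h.1 x hx) (hC v hv h.2 y hy)
  · exact hr.lie_bottomFamily_topFamily hV (hC u hu h.1 x hx) (hB v hv h.2 y hy)

theorem lowerCentralFamily_one_eq_bot (hr : IsRanking X k r) (hV : GradedFamily X V)
    (hk : k ≤ 1) : lowerCentralFamily V 1 = ⊥ := by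
  rw [lowerCentralFamily_succ, ← le_bot_iff]
  refine lieProd_le fun u v x hx y hy => ?_
  rw [Pi.bot_apply, Submodule.mem_bot]
  by_cases hx0 : x = 0
  · rw [hx0, zero_lie]
  by_cases hy0 : y = 0
  · rw [hy0, lie_zero]
  have hu := hV.mem_support hx hx0
  have hv := hV.mem_support hy hy0
  have := hr.one_le hu
  have := hr.one_le hv
  have := hr.le hu
  have := hr.le hv
  exact hr.lie_top_bottom hV hu hv (by omega) (by omega) hx hy

/-- Components of distinct degrees commute, and a nonzero bracket within one degree lands in the
other. Jacobi then kills all triple brackets. -/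
theorem lowerCentralFamily_two_eq_bot (hr : IsRanking X 2 r) (hV : GradedFamily X V) :
    lowerCentralFamily V 2 = ⊥ := by
  have comm (u v : A) (hu : u ∈ X) (hv : v ∈ X) (huv : r u ≠ r v) (x y : L) (hx : x ∈ V u)
      (hy : y ∈ V v) : ⁅x, y⁆ = 0 := by
    have := hr.one_le hu
    have := hr.one_le hv
    have := hr.le hu
    have := hr.le hv
    obtain h | h : r u = 2 ∨ r u = 1 := by omega
    · exact hr.lie_top_bottom hV hu hv h (by omega) hx hy
    · rw [← lie_skew, hr.lie_top_bottom hV hv hu (by omega) h hy hx, neg_zero]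
  rw [lowerCentralFamily_succ, lowerCentralFamily_succ, lowerCentralFamily_zero, ← le_bot_iff]
  refine lieProd_le fun u t x hx w hw => ?_
  refine lie_right_mem_of_lieProd ?_ hw
  rintro v s rfl y hy z hz
  rw [Pi.bot_apply, Submodule.mem_bot]
  by_cases hx0 : x = 0
  · rw [hx0, zero_lie]
  by_cases hyz0 : ⁅y, z⁆ = 0
  · rw [hyz0, lie_zero]
  have hu := hV.mem_support hx hx0
  have hv := hV.mem_support hy fun h => hyz0 (by rw [h, zero_lie])
  have hs := hV.mem_support hz fun h => hyz0 (by rw [h, lie_zero])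
  have hvs := hV.mem_support (hV.lie_mem hy hz) hyz0
  have h₁ : r v = r s := by_contra fun h => hyz0 (comm v s hv hs h y z hy hz)
  by_cases h₂ : r u = r v
  · refine comm u _ hu hvs ?_ x _ hx (hV.lie_mem hy hz)
    have := hr.lt_or_lt hv hs hvs
    omega
  · rw [leibniz_lie, comm u v hu hv h₂ x y hx hy, comm u s hu hs (h₁ ▸ h₂) x z hx hz, zero_lie,
      lie_zero, add_zero]

end IsRanking

end Solvable

/-! ### The invariant δ and traces on abelian subgroups -/

/-- Without escape, the sets `S j` of products of `a` with subproducts of the first `j` factors stay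
in `Y`. They grow strictly, since a stable `S j` contains all `a * c ^ m`, making `c` a period of
the finite set `Y`. Then `S n` has more than `n` elements. -/
theorem escapesIn_of_ncard_le {A : Type*} [CommGroup A] {Y : Set A} (hY : Y.Finite)
    (hfree : Y ∩ periods Y = ∅) {n : ℕ} (hn : Y.ncard ≤ n) : EscapesIn Y n := by
  classical
  intro a ha b hb
  by_contra! hI
  let S (j : ℕ) : Set A := {x | ∃ I : Finset (Fin n), (∀ i ∈ I, (i : ℕ) < j) ∧
    a * ∏ i ∈ I, b i = x}
  have hSY (j : ℕ) : S j ⊆ Y := by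
    rintro _ ⟨I, -, rfl⟩
    exact hI I
  have hmono (j : ℕ) : S j ⊆ S (j + 1) := by
    rintro _ ⟨I, hj, rfl⟩
    exact ⟨I, fun i hi => (hj i hi).trans (Nat.lt_succ_self j), rfl⟩
  have hmul (j : ℕ) (hj : j < n) (x : A) (hx : x ∈ S j) : x * b ⟨j, hj⟩ ∈ S (j + 1) := by
    obtain ⟨I, hi, rfl⟩ := hx
    have hjI : (⟨j, hj⟩ : Fin n) ∉ I := fun h => (hi _ h).false
    refine ⟨insert ⟨j, hj⟩ I, fun i h => ?_, ?_⟩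
    · obtain rfl | h := Finset.mem_insert.1 h
      · exact Nat.lt_succ_self j
      · exact (hi i h).trans (Nat.lt_succ_self j)
    · rw [Finset.prod_insert hjI, mul_assoc, mul_comm (b _)]
  have hne (j : ℕ) (hj : j < n) : S (j + 1) ≠ S j := by
    intro h
    set c := b ⟨j, hj⟩
    have hpow (m : ℕ) : a * c ^ m ∈ S j := by
      induction m with
      | zero => exact ⟨∅, by simp, by simp⟩
      | succ m ih =>
        rw [pow_succ, ← mul_assoc, ← h]
        exact hmul j hj _ ih
    have hfin : IsOfFinOrder c := by
      by_contra hc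
      refine Set.infinite_of_injective_forall_mem (f := fun m : ℕ => a * c ^ m) ?_
        (fun m => hSY j (hpow m)) hY
      exact (mul_right_injective a).comp (injective_pow_iff_not_isOfFinOrder.2 hc)
    have hper : c ∈ Y ∩ periods Y := by
      refine ⟨hb _, a, ha, fun g hg => ?_⟩
      obtain ⟨m, rfl⟩ := hfin.mem_powers_iff_mem_zpowers.2 hg
      exact hSY j (hpow m)
    rw [hfree] at hper
    exact hper
  have hcard (j : ℕ) (hj : j ≤ n) : j + 1 ≤ (S j).ncard := by
    induction j with
    | zero =>
      refine (Set.ncard_pos (hY.subset (hSY 0))).2 ⟨a, ∅, by simp, by simp⟩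
    | succ j ih =>
      have := Set.ncard_lt_ncard ((hmono j).ssubset_of_ne (hne j hj).symm) (hY.subset (hSY _))
      have := ih (by omega)
      omega
  have := hcard n le_rfl
  have := Set.ncard_le_ncard (hSY n) hY
  omega

section Trace

variable {G : Type*} [Group G] {X : Set G}

theorem traceOn_finite (hX : X.Finite) (H : Subgroup G) : (traceOn X H).Finite :=
  hX.preimage Subtype.val_injective.injOn

theorem ncard_traceOn_le (hX : X.Finite) (H : Subgroup G) : (traceOn X H).ncard ≤ X.ncard :=
  Set.ncard_le_ncard_of_injOn Subtype.val (fun _ h => h) Subtype.val_injective.injOn hX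

open scoped IsMulCommutative in
theorem ArithmeticallyFree.ncard_mem (hfree : ArithmeticallyFree X) (hX : 1 ≤ X.ncard) :
    X.ncard ∈ {d : ℕ | 1 ≤ d ∧ ∀ (H : Subgroup G) [IsMulCommutative H],
      EscapesIn (traceOn X H) d} :=
  ⟨hX, fun H _ => escapesIn_of_ncard_le (traceOn_finite hfree.1 H) (hfree.2 H)
    (ncard_traceOn_le hfree.1 H)⟩

theorem ArithmeticallyFree.deltaInv_le_ncard (hfree : ArithmeticallyFree X) (hX : 1 ≤ X.ncard) :
    deltaInv X ≤ X.ncard :=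
  Nat.sInf_le (hfree.ncard_mem hX)

open scoped IsMulCommutative in
theorem ArithmeticallyFree.escapesIn_deltaInv (hfree : ArithmeticallyFree X) (hX : 1 ≤ X.ncard)
    (H : Subgroup G) [IsMulCommutative H] : EscapesIn (traceOn X H) (deltaInv X) :=
  (Nat.sInf_mem ⟨_, hfree.ncard_mem hX⟩).2 H

theorem HasGoodOrdering.exists_rank {Y : Set G} (hY : HasGoodOrdering Y) (hfin : Y.Finite) :
    ∃ r : G → ℕ, (∀ g ∈ Y, 1 ≤ r g ∧ r g ≤ Y.ncard) ∧ Set.InjOn r Y ∧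
      ∀ u ∈ Y, ∀ v ∈ Y, u * v ∈ Y → ¬ (r u < r (u * v) ∧ r (u * v) < r v) := by
  classical
  obtain ⟨_, hgood⟩ := hY
  have := hfin.fintype
  let e : Y ≃o Fin (Fintype.card Y) := (Fintype.orderIsoFinOfCardEq Y rfl).symm
  let r (g : G) : ℕ := if h : g ∈ Y then e ⟨g, h⟩ + 1 else 0
  have hr (g : G) (h : g ∈ Y) : r g = e ⟨g, h⟩ + 1 := dif_pos h
  have hlt (g h : G) (hg : g ∈ Y) (hh : h ∈ Y) (H : r g < r h) :
      (⟨g, hg⟩ : Y) < ⟨h, hh⟩ := by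
    rw [hr g hg, hr h hh, Nat.add_lt_add_iff_right] at H
    exact e.lt_iff_lt.1 H
  refine ⟨r, fun g hg => ?_, fun g hg h hh H => ?_, fun u hu v hv huv H => ?_⟩
  · rw [hr g hg, ← Nat.card_coe_set_eq, Nat.card_eq_fintype_card]
    exact ⟨by omega, (e _).isLt⟩
  · rw [hr g hg, hr h hh, Nat.add_right_cancel_iff] at H
    exact congrArg Subtype.val (e.injective (Fin.ext H))
  · exact hgood ⟨u, hu⟩ ⟨v, hv⟩ ⟨u * v, huv⟩ rfl
      ⟨hlt _ _ hu huv H.1, hlt _ _ huv hv H.2⟩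

open scoped IsMulCommutative in
theorem GoodOrdered.exists_isRanking (hgood : GoodOrdered X) (hfree : ArithmeticallyFree X)
    (H : Subgroup G) [IsMulCommutative H] : ∃ r : H → ℕ, IsRanking (traceOn X H) X.ncard r := by
  have hcomm : ∀ x ∈ X ∩ H, ∀ y ∈ X ∩ H, x * y = y * x := fun x hx y hy =>
    congrArg Subtype.val (mul_comm (⟨x, hx.2⟩ : H) ⟨y, hy.2⟩)
  have hfin : (X ∩ H).Finite := hfree.1.subset Set.inter_subset_left
  obtain ⟨r, h₁, h₂, h₃⟩ := (hgood _ Set.inter_subset_left hcomm).exists_rank hfin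
  have hmem (h : H) (hh : h ∈ traceOn X H) : (h : G) ∈ X ∩ H := ⟨hh, h.2⟩
  refine ⟨fun h => r h, ⟨fun h => ?_, fun g hg => (h₁ g (hmem g hg)).1, fun g hg => ?_, ?_, ?_⟩⟩
  -- If `1` were in the trace, it would trivially be a period of it.
  · have : (1 : H) ∈ traceOn X H ∩ periods (traceOn X H) := by
      refine ⟨h, 1, h, fun g hg => ?_⟩
      rw [Subgroup.zpowers_one_eq_bot, Subgroup.mem_bot] at hg
      rwa [hg, mul_one]
    rw [hfree.2 H] at this
    exact this
  -- Ranks need not fill `1, …, k`, so the same `k = |X|` serves every trace.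
  · exact (h₁ g (hmem g hg)).2.trans (Set.ncard_le_ncard Set.inter_subset_left hfree.1)
  · exact fun g hg h hh H => Subtype.ext (h₂ (hmem g hg) (hmem h hh) H)
  · exact fun u v hu hv huv => h₃ u (hmem u hu) v (hmem v hv) (hmem _ huv)

open scoped IsMulCommutative in
theorem ArithmeticallyFree.mul_notMem_of_mul_self_eq_one (hfree : ArithmeticallyFree X)
    (H : Subgroup G) [IsMulCommutative H] (x : H) (hx : x ∈ traceOn X H) (y : H)
    (hy : y ∈ traceOn X H) (hyy : y * y = 1) : x * y ∉ traceOn X H := by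
  intro hxy
  have : y ∈ traceOn X H ∩ periods (traceOn X H) := by
    refine ⟨hy, x, hx, fun g hg => ?_⟩
    obtain ⟨n, rfl⟩ := Subgroup.mem_zpowers_iff.1 hg
    obtain ⟨m, rfl | rfl⟩ := Int.even_or_odd' n
    · rwa [zpow_mul, zpow_two, hyy, one_zpow, mul_one]
    · rwa [zpow_add, zpow_mul, zpow_two, hyy, one_zpow, one_mul, zpow_one]
  rw [hfree.2 H] at this
  exact this

end Trace

/-! ### Reduction to abelian subgroups -/

theorem lowerCentralSeries_le_span_listLie {ι K L : Type*} [CommRing K] [LieRing L]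
    [LieAlgebra K L] {𝓛 : ι → Submodule K L} (h : ⨆ g, 𝓛 g = ⊤) (n : ℕ) :
    LieSubmodule.toSubmodule (LieModule.lowerCentralSeries K L L n) ≤
      Submodule.span K {w | ∃ a, ∃ z ∈ 𝓛 a, ∃ l : List (ι × L),
        (∀ p ∈ l, p.2 ∈ 𝓛 p.1) ∧ l.length = n ∧ listLie l z = w} := by
  have hspan : Submodule.span K (⋃ g, (𝓛 g : Set L)) = ⊤ := by
    rw [← h, Submodule.iSup_eq_span]
  induction n with
  | zero =>
    rw [LieModule.lowerCentralSeries_zero, LieSubmodule.top_toSubmodule, ← hspan]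
    refine Submodule.span_mono fun z hz => ?_
    obtain ⟨a, hz⟩ := Set.mem_iUnion.1 hz
    exact ⟨a, z, hz, [], by simp, rfl, rfl⟩
  | succ n ih =>
    rw [LieModule.lowerCentralSeries_succ, LieSubmodule.lieIdeal_oper_eq_linear_span',
      Submodule.span_le]
    rintro _ ⟨x, -, w, hw, rfl⟩
    set P := Submodule.span K {w | ∃ a, ∃ z ∈ 𝓛 a, ∃ l : List (ι × L),
        (∀ p ∈ l, p.2 ∈ 𝓛 p.1) ∧ l.length = n + 1 ∧ listLie l z = w}
    have hx : x ∈ Submodule.span K (⋃ g, (𝓛 g : Set L)) := hspan ▸ Submodule.mem_top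
    change ⁅x, w⁆ ∈ P
    induction hx using Submodule.span_induction with
    | mem x hx =>
      obtain ⟨g, hx⟩ := Set.mem_iUnion.1 hx
      rw [← LieModule.toEnd_apply_apply K, ← Submodule.mem_comap]
      refine (ih.trans (Submodule.span_le.2 ?_)) hw
      rintro _ ⟨a, z, hz, l, hl, hln, rfl⟩
      exact Submodule.subset_span ⟨a, z, hz, (g, x) :: l, List.forall_mem_cons.2 ⟨hx, hl⟩,
        by simp [hln], rfl⟩
    | zero => rw [zero_lie]; exact zero_mem _
    | add x y _ _ h₁ h₂ => rw [add_lie]; exact add_mem h₁ h₂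
    | smul c x _ h => rw [smul_lie]; exact P.smul_mem c h

section Grading

variable {G K L : Type*} [Group G] [CommRing K] [LieRing L] [LieAlgebra K L]
  {𝓛 : G → Submodule K L}

namespace IsGroupGrading

variable [DecidableEq G]

/-- By antisymmetry the bracket lies in both `𝓛 (g * h)` and `𝓛 (h * g)`, which are independent if
the degrees differ. -/
theorem commute_of_lie_ne_zero (h𝓛 : IsGroupGrading 𝓛) {g h : G} {x y : L} (hx : x ∈ 𝓛 g)
    (hy : y ∈ 𝓛 h) (hxy : ⁅x, y⁆ ≠ 0) : Commute g h := by
  by_contra hgh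
  have h₁ := h𝓛.lie_mem hx hy
  have h₂ : ⁅x, y⁆ ∈ 𝓛 (h * g) := by
    rw [← lie_skew]; exact neg_mem (h𝓛.lie_mem hy hx)
  exact hxy (Submodule.disjoint_def.1
    (h𝓛.isInternal.submodule_iSupIndep.pairwiseDisjoint hgh) _ h₁ h₂)

theorem listLie_mem (h𝓛 : IsGroupGrading 𝓛) {a : G} {z : L} (hz : z ∈ 𝓛 a) (l : List (G × L))
    (hl : ∀ p ∈ l, p.2 ∈ 𝓛 p.1) : listLie l z ∈ 𝓛 ((l.map Prod.fst).prod * a) := by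
  induction l with
  | nil => simpa using hz
  | cons p l ih =>
    rw [List.map_cons, List.prod_cons, mul_assoc]
    exact h𝓛.lie_mem (hl p (by simp)) (ih fun q hq => hl q (by simp [hq]))

/-- Expand by Jacobi across the head `p`: a surviving term lets the induction hypothesis apply to
`g` or to `g * p.1`. The remaining commutations follow by cancelling factors already known to
commute. -/
theorem commute_of_lie_listLie_ne_zero (h𝓛 : IsGroupGrading 𝓛) {a : G} {z : L} (hz : z ∈ 𝓛 a)
    (l : List (G × L)) (hl : ∀ p ∈ l, p.2 ∈ 𝓛 p.1) :
    ∀ (g : G) (y : L), y ∈ 𝓛 g → ⁅y, listLie l z⁆ ≠ 0 →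
      Commute g a ∧ ∀ p ∈ l, Commute g p.1 := by
  induction l with
  | nil => exact fun g y hy h => ⟨h𝓛.commute_of_lie_ne_zero hy hz h, by simp⟩
  | cons p l ih =>
    intro g y hy h
    have hp := hl p (by simp)
    have hl' : ∀ q ∈ l, q.2 ∈ 𝓛 q.1 := fun q hq => hl q (by simp [hq])
    replace ih := ih hl'
    have hm := h𝓛.listLie_mem hz l hl'
    have h0 : ⁅p.2, listLie l z⁆ ≠ 0 := fun h0 => h (by rw [listLie_cons, h0, lie_zero])
    obtain ⟨hpa, hpl⟩ := ih p.1 p.2 hp h0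
    have hgp := h𝓛.commute_of_lie_ne_zero hy (h𝓛.lie_mem hp hm) h
    rw [listLie_cons, leibniz_lie] at h
    by_cases h₁ : ⁅y, p.2⁆ = 0
    · rw [h₁, zero_lie, zero_add] at h
      obtain ⟨hga, hgl⟩ := ih g y hy fun h₂ => h (by rw [h₂, lie_zero])
      have hprod : Commute g ((l.map Prod.fst).prod * a) := by
        refine (Commute.list_prod_right _ _ fun s hs => ?_).mul_right hga
        obtain ⟨q, hq, rfl⟩ := List.mem_map.1 hs
        exact hgl q hq
      have hp' : Commute g p.1 := by
        have := hgp.mul_right hprod.inv_right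
        rwa [mul_inv_cancel_right] at this
      exact ⟨hga, List.forall_mem_cons.2 ⟨hp', hgl⟩⟩
    · have hgp' := h𝓛.commute_of_lie_ne_zero hy hp h₁
      by_cases h₂ : ⁅⁅y, p.2⁆, listLie l z⁆ = 0
      · rw [h₂, zero_add] at h
        obtain ⟨hga, hgl⟩ := ih g y hy fun h₂ => h (by rw [h₂, lie_zero])
        exact ⟨hga, List.forall_mem_cons.2 ⟨hgp', hgl⟩⟩
      · obtain ⟨hga, hgl⟩ := ih _ _ (h𝓛.lie_mem hy hp) h₂
        have cancel (t : G) (ht : Commute (g * p.1) t) (hpt : Commute p.1 t) : Commute g t := by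
          have := ht.mul_left hpt.inv_left
          rwa [mul_inv_cancel_right] at this
        exact ⟨cancel a hga hpa, List.forall_mem_cons.2
          ⟨hgp', fun q hq => cancel q.1 (hgl q hq) (hpl q hq)⟩⟩

theorem commute_of_listLie_ne_zero (h𝓛 : IsGroupGrading 𝓛) {a : G} {z : L} (hz : z ∈ 𝓛 a)
    (l : List (G × L)) (hl : ∀ p ∈ l, p.2 ∈ 𝓛 p.1) (h : listLie l z ≠ 0) :
    ∀ s ∈ a :: l.map Prod.fst, ∀ t ∈ a :: l.map Prod.fst, s * t = t * s := by
  induction l with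
  | nil => simp
  | cons p l ih =>
    have hl' : ∀ q ∈ l, q.2 ∈ 𝓛 q.1 := fun q hq => hl q (by simp [hq])
    rw [listLie_cons] at h
    obtain ⟨h₁, h₂⟩ := h𝓛.commute_of_lie_listLie_ne_zero hz l hl' p.1 p.2 (hl p (by simp)) h
    replace ih := ih hl' fun h0 => h (by rw [h0, lie_zero])
    have hp : ∀ s ∈ a :: l.map Prod.fst, Commute p.1 s := by
      refine List.forall_mem_cons.2 ⟨h₁, fun s hs => ?_⟩
      obtain ⟨q, hq, rfl⟩ := List.mem_map.1 hs
      exact h₂ q hq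
    have hmem : ∀ s ∈ a :: (p :: l).map Prod.fst, s = p.1 ∨ s ∈ a :: l.map Prod.fst := by
      intro s hs
      simp only [List.map_cons, List.mem_cons] at hs ⊢
      tauto
    intro s hs t ht
    obtain rfl | hs := hmem s hs <;> obtain rfl | ht := hmem t ht
    · rfl
    · exact hp t ht
    · exact (hp s hs).symm
    · exact ih s hs t ht

open scoped IsMulCommutative in
theorem gradedFamily_traceOn (h𝓛 : IsGroupGrading 𝓛) (H : Subgroup G) [IsMulCommutative H] :
    GradedFamily (traceOn (gradingSupport 𝓛) H) (fun h : H => 𝓛 h) where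
  lie_mem _ _ _ _ hx hy := h𝓛.lie_mem hx hy
  mem_support g x hx h0 h := h0 (by rwa [h] at hx)

open scoped IsMulCommutative in
theorem lowerCentralSeries_eq_bot (h𝓛 : IsGroupGrading 𝓛) {c : ℕ}
    (hc : ∀ (H : Subgroup G) [IsMulCommutative H],
      lowerCentralFamily (fun h : H => 𝓛 h) c = ⊥) :
    LieModule.lowerCentralSeries K L L c = ⊥ := by
  rw [← LieSubmodule.toSubmodule_inj, LieSubmodule.bot_toSubmodule, ← le_bot_iff]
  refine (lowerCentralSeries_le_span_listLie h𝓛.isInternal.submodule_iSup_eq_top c).trans ?_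
  rw [Submodule.span_le]
  rintro _ ⟨a, z, hz, l, hl, rfl, rfl⟩
  by_contra h
  have hcomm := h𝓛.commute_of_listLie_ne_zero hz l hl h
  set S : Set G := {s | s ∈ a :: l.map Prod.fst}
  have : IsMulCommutative (Subgroup.closure S) :=
    Subgroup.isMulCommutative_closure hcomm
  have hS (s : G) (hs : s ∈ a :: l.map Prod.fst) : s ∈ Subgroup.closure S :=
    Subgroup.subset_closure hs
  have key (m : List (G × L)) (hm : ∀ p ∈ m, p ∈ l) : ∃ h : Subgroup.closure S,
      listLie m z ∈ lowerCentralFamily (fun h : Subgroup.closure S => 𝓛 h) m.length h := by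
    induction m with
    | nil => exact ⟨⟨a, hS a (by simp)⟩, hz⟩
    | cons p m ih =>
      obtain ⟨h, hh⟩ := ih fun q hq => hm q (by simp [hq])
      have hp := hm p (by simp)
      refine ⟨⟨p.1, hS _ (List.mem_cons_of_mem _ (List.mem_map_of_mem hp))⟩ * h, ?_⟩
      rw [List.length_cons, lowerCentralFamily_succ, listLie_cons]
      exact lie_mem_lieProd (hl p hp) hh rfl
  obtain ⟨g, hg⟩ := key l fun _ => id
  rw [hc] at hg
  exact h hg

end IsGroupGrading

end Grading

/-! ### Nilpotency class and numerical bounds -/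

section NilpotencyLength

variable {K L : Type*} [CommRing K] [LieRing L] [LieAlgebra K L]

theorem nilpotencyLength_le_of_lowerCentralSeries_eq_bot {c : ℕ}
    (h : LieModule.lowerCentralSeries K L L c = ⊥) : LieModule.nilpotencyLength L L ≤ c := by
  refine Nat.sInf_le ?_
  -- `LieModule.nilpotencyLength` is computed over `ℤ`; the underlying series does not depend on the
  -- coefficient ring.
  have := LieModule.coe_lowerCentralSeries_eq_int K L L c
  rw [h] at this
  exact SetLike.coe_injective (by simpa using this.symm)

end NilpotencyLength

theorem sum_pow_le_pow {d k : ℕ} (hdk : d ≤ k) (hk : 2 ≤ k) (n : ℕ) :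
    ∑ i ∈ Finset.range n, d ^ i ≤ k ^ n :=
  (Finset.sum_le_sum fun i _ => Nat.pow_le_pow_left hdk i).trans (Nat.geomSum_lt hk (by simp)).le

namespace IsGroupGrading

variable {G K L : Type*} [Group G] [DecidableEq G] [CommRing K] [LieRing L] [LieAlgebra K L]
  {𝓛 : G → Submodule K L}

open scoped IsMulCommutative in
theorem lowerCentralSeries_one_eq_bot (h𝓛 : IsGroupGrading 𝓛)
    (hfree : ArithmeticallyFree (gradingSupport 𝓛)) (hgood : GoodOrdered (gradingSupport 𝓛))
    (h : (gradingSupport 𝓛).ncard ≤ 1) : LieModule.lowerCentralSeries K L L 1 = ⊥ :=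
  h𝓛.lowerCentralSeries_eq_bot fun H _ => by
    obtain ⟨r, hr⟩ := hgood.exists_isRanking hfree H
    exact hr.lowerCentralFamily_one_eq_bot (h𝓛.gradedFamily_traceOn H) h

open scoped IsMulCommutative in
theorem lowerCentralSeries_two_eq_bot (h𝓛 : IsGroupGrading 𝓛)
    (hfree : ArithmeticallyFree (gradingSupport 𝓛)) (hgood : GoodOrdered (gradingSupport 𝓛))
    (h : (gradingSupport 𝓛).ncard = 2) : LieModule.lowerCentralSeries K L L 2 = ⊥ :=
  h𝓛.lowerCentralSeries_eq_bot fun H _ => by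
    obtain ⟨r, hr⟩ := hgood.exists_isRanking hfree H
    rw [h] at hr
    exact hr.lowerCentralFamily_two_eq_bot (h𝓛.gradedFamily_traceOn H)

open scoped IsMulCommutative in
theorem lowerCentralSeries_sum_eq_bot (h𝓛 : IsGroupGrading 𝓛)
    (hfree : ArithmeticallyFree (gradingSupport 𝓛)) (hgood : GoodOrdered (gradingSupport 𝓛))
    (h : 3 ≤ (gradingSupport 𝓛).ncard) :
    LieModule.lowerCentralSeries K L L (∑ i ∈ Finset.range
      (2 ^ ((gradingSupport 𝓛).ncard - 1) - 1), deltaInv (gradingSupport 𝓛) ^ i) = ⊥ :=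
  h𝓛.lowerCentralSeries_eq_bot fun H _ => by
    obtain ⟨r, hr⟩ := hgood.exists_isRanking hfree H
    have hV := h𝓛.gradedFamily_traceOn H
    exact hV.lowerCentralFamily_eq_bot (hfree.escapesIn_deltaInv (by omega) H) _
      (hr.derivedFamily_eq_bot hV h (hfree.mul_notMem_of_mul_self_eq_one H))

end IsGroupGrading

theorem mainTheorem1 {G K L : Type*} [Group G] [DecidableEq G] [CommRing K] [LieRing L]
    [LieAlgebra K L] (𝓛 : G → Submodule K L) (h𝓛 : IsGroupGrading 𝓛)
    (X : Set G) (hX : X = gradingSupport 𝓛)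
    (hfree : ArithmeticallyFree X) (hgood : GoodOrdered X) :
    LieRing.IsNilpotent L ∧
    (3 ≤ X.ncard → LieModule.nilpotencyLength L L ≤
      ∑ i ∈ Finset.range (2 ^ (X.ncard - 1) - 1), deltaInv X ^ i) ∧
    (1 ≤ X.ncard → ∑ i ∈ Finset.range (2 ^ (X.ncard - 1) - 1), deltaInv X ^ i ≤
      X.ncard ^ (2 ^ (X.ncard - 1) - 1)) ∧
    (1 ≤ X.ncard →
      LieModule.nilpotencyLength L L ≤ X.ncard ^ (2 ^ (X.ncard - 1) - 1)) := by
  subst hX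
  set X := gradingSupport 𝓛
  have hsum (h : 1 ≤ X.ncard) : ∑ i ∈ Finset.range (2 ^ (X.ncard - 1) - 1), deltaInv X ^ i ≤
      X.ncard ^ (2 ^ (X.ncard - 1) - 1) := by
    obtain h₁ | h₂ := h.eq_or_lt
    -- For `|X| = 1` the sum is empty and the right side is `1`.
    · simp [← h₁]
    · exact sum_pow_le_pow (hfree.deltaInv_le_ncard h) h₂ _
  obtain h | h | h : X.ncard ≤ 1 ∨ X.ncard = 2 ∨ 3 ≤ X.ncard := by omega
  · have h₀ := h𝓛.lowerCentralSeries_one_eq_bot hfree hgood h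
    refine ⟨(LieModule.isNilpotent_iff K L L).2 ⟨_, h₀⟩, fun _ => by omega, hsum, fun h' => ?_⟩
    refine (nilpotencyLength_le_of_lowerCentralSeries_eq_bot h₀).trans ?_
    exact Nat.one_le_pow _ _ h'
  · have h₀ := h𝓛.lowerCentralSeries_two_eq_bot hfree hgood h
    refine ⟨(LieModule.isNilpotent_iff K L L).2 ⟨_, h₀⟩, fun _ => by omega, hsum, fun _ => ?_⟩
    refine (nilpotencyLength_le_of_lowerCentralSeries_eq_bot h₀).trans ?_
    simp [h]
  · have h₀ := h𝓛.lowerCentralSeries_sum_eq_bot hfree hgood h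
    have hlen := nilpotencyLength_le_of_lowerCentralSeries_eq_bot h₀
    exact ⟨(LieModule.isNilpotent_iff K L L).2 ⟨_, h₀⟩, fun _ => hlen, hsum,
      fun h' => hlen.trans (hsum h')⟩
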